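/- Let $(X,d)$ be a compact metric space and let $f:X\to X$ be a homeomorphism that is pointwise periodic, i.e. for every $x\in X$ there is $n\ge 1$ with $f^n(x)=x$. Let $2^X$ be the set of all nonempty closed subsets of $X$ with the Hausdorff metric, and let $2^f:2^X\to 2^X$, $2^f(A)=f(A)$. For a continuous map $g$ of a compact metric space $(Y,\rho)$ and $x,y\in Y$ we use the following notions. - $(Y,g)$ is *equicontinuous* if the family $\{g^n:n\ge 0\}$ is equicontinuous. - $\omega_g(x)=\bigcap_{n\ge 0}\overline{\{g^k(x):k\ge n\}}$. - $R(g)=\{x:x\in\omega_g(x)\}$ is the set of recurrent points. $AP(g)$ is the set of almost periodic points: those $x$ such that for every neighbourhood $U$ of $x$ there is $N\in\mathbb N$ with $\{g^{n+i}(x):0\le i\le N\}\cap U\ne\emptyset$ for all $n\ge 0$. - $(x,y)$ is a *Li–Yorke pair* if $\liminf_{n\to\infty}\rho(g^n(x),g^n(y))=0$ and $\limsup_{n\to\infty}\rho(g^n(x),g^n(y))\neq 0$. A set $S\subset Y$ is *scrambled* if any two distinct points of $S$ form a Li–Yorke pair, and $g$ is *Li–Yorke chaotic* if it has an uncountable scrambled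 set. - A set $S\subset Y$ with at least two points is *$\omega$-scrambled* if for all $x\neq y$ in $S$: (i) $\omega_g(x)\setminus\omega_g(y)$ is uncountable; (ii) $\omega_g(x)\cap\omega_g(y)\neq\emptyset$; (iii) $\omega_g(x)$ contains a point that is not periodic for $g$. The map $g$ is *$\omega$-chaotic* if it has an uncountable $\omega$-scrambled set. **Theorem.** The following are equivalent: 1. $(X,f)$ is not equicontinuous; 2. $(2^X,2^f)$ is not equicontinuous; 3. there is an uncountable set $S\subset R(2^f)$ which is both a scrambled and an $\omega$-scrambled set for $2^f$; in particular $2^f$ is both Li–Yorke chaotic and $\omega$-chaotic; 4. $2^f$ has a Li–Yorke pair; 5. $2^f$ has an $\omega$-scrambled set with at least two points; 6. $R(2^f)\setminus AP(2^f)\neq\emptyset$. -/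

import Mathlib

open Filter Topology

namespace HyperDyn

section Dynamics

variable {Y : Type*} [MetricSpace Y]

/-- The dynamical system `(Y, g)` is equicontinuous: the family of iterates `g^n`, `n ≥ 0`, is
equicontinuous at every point (on a compact space this is the same as uniform equicontinuity). -/
def IsEquicontinuous (g : Y → Y) : Prop :=
  Equicontinuous (fun (n : ℕ) => g^[n])

/-- Every point is periodic with some positive period. -/
def PointwisePeriodic (g : Y → Y) : Prop :=
  ∀ x, x ∈ Function.periodicPts g

/-- The ω-limit set of the point `x` under `g`. -/
def omegaSet (g : Y → Y) (x : Y) : Set Y :=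
  omegaLimit atTop (fun (n : ℕ) (y : Y) => g^[n] y) {x}

/-- The ω-limit set is the intersection over `n` of the closures of `{g^k(x) : k ≥ n}`. -/
theorem omegaSet_eq (g : Y → Y) (x : Y) :
    omegaSet g x = ⋂ n : ℕ, closure {y | ∃ k, n ≤ k ∧ g^[k] x = y} := by
  ext y
  simp only [omegaSet, omegaLimit_def, Set.mem_iInter, Set.image2_singleton_right]
  constructor
  · intro h n
    exact closure_mono (by rintro _ ⟨k, hk, rfl⟩; exact ⟨k, hk, rfl⟩) (h (Set.Ici n) (Ici_mem_atTop n))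
  · intro h u hu
    obtain ⟨n, hn⟩ := mem_atTop_sets.1 hu
    exact closure_mono (by rintro _ ⟨k, hk, rfl⟩; exact ⟨k, hn k hk, rfl⟩) (h n)

/-- `R(g)`: the set of recurrent points. -/
def recurrentPts (g : Y → Y) : Set Y :=
  {x | x ∈ omegaSet g x}

/-- `AP(g)`: the set of almost periodic points, i.e. those which return to each of their
neighbourhoods with bounded gaps. -/
def almostPeriodicPts (g : Y → Y) : Set Y :=
  {x | ∀ U ∈ 𝓝 x, ∃ N : ℕ, ∀ n : ℕ, ∃ i ≤ N, g^[n + i] x ∈ U}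

/-- `(x, y)` is proximal: `liminf d(g^n(x), g^n(y)) = 0`. (The distance is taken in `[0, ∞]`, so
that the `liminf` is the true one without any boundedness proviso.) -/
def IsProximal (g : Y → Y) (x y : Y) : Prop :=
  liminf (fun n : ℕ => edist (g^[n] x) (g^[n] y)) atTop = 0

/-- `(x, y)` is asymptotic: `limsup d(g^n(x), g^n(y)) = 0`. -/
def IsAsymptotic (g : Y → Y) (x y : Y) : Prop :=
  limsup (fun n : ℕ => edist (g^[n] x) (g^[n] y)) atTop = 0

/-- A Li–Yorke pair: proximal but not asymptotic. -/
def IsLiYorkePair (g : Y → Y) (x y : Y) : Prop :=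
  IsProximal g x y ∧ ¬ IsAsymptotic g x y

/-- A scrambled set: any two distinct points form a Li–Yorke pair. -/
def IsScrambled (g : Y → Y) (S : Set Y) : Prop :=
  ∀ x ∈ S, ∀ y ∈ S, x ≠ y → IsLiYorkePair g x y

/-- An ω-scrambled set; by definition it has at least two points. -/
def IsOmegaScrambled (g : Y → Y) (S : Set Y) : Prop :=
  S.Nontrivial ∧ ∀ x ∈ S, ∀ y ∈ S, x ≠ y →
    ¬ (omegaSet g x \ omegaSet g y).Countable ∧
    (omegaSet g x ∩ omegaSet g y).Nonempty ∧
    ¬ omegaSet g x ⊆ Function.periodicPts g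

/-- Li–Yorke chaos: there is an uncountable scrambled set. -/
def IsLiYorkeChaotic (g : Y → Y) : Prop :=
  ∃ S : Set Y, ¬ S.Countable ∧ IsScrambled g S

/-- ω-chaos: there is an uncountable ω-scrambled set. -/
def IsOmegaChaotic (g : Y → Y) : Prop :=
  ∃ S : Set Y, ¬ S.Countable ∧ IsOmegaScrambled g S

end Dynamics

/-- The map `2^f : A ↦ f(A)` on the hyperspace `2^X` of nonempty closed subsets of a compact metric
space `X`. As `X` is compact, these are the nonempty compact subsets, and Mathlib's metric on
`NonemptyCompacts X` is the Hausdorff metric. -/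
def hyperMap {X : Type*} [MetricSpace X] (f : X → X) (hf : Continuous f) :
    TopologicalSpace.NonemptyCompacts X → TopologicalSpace.NonemptyCompacts X :=
  TopologicalSpace.NonemptyCompacts.map f hf

end HyperDyn

/-!
Equicontinuity of `f` passes to the hyperspace directly from the Hausdorff metric, and an
equicontinuous system on a compact space has minimal ω-limit sets
(`IsEquicontinuous.omegaSet_subset`), no Li–Yorke pairs and only almost periodic recurrent points.
So all the chaotic conditions fail when `f` is equicontinuous, and the content of the theorem is
the construction of an uncountable set of recurrent points of `hyperMap f`, scrambled and
ω-scrambled, when `f` is not equicontinuous (`exists_scrambled_of_not_isEquicontinuous`).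

Let `x` be a point at which `f` is not equicontinuous, of period `p`, and `g = f^[p]`. The
prolongation of `x`, that is the set of limits of `g^[kᵢ] yᵢ` with `yᵢ → x`, is then larger than
`{x}`. It cannot be split into two nonempty closed parts, the one containing `x` being invariant
(`prolongation_subset_of_isClosed_diff`); as orbits are finite, it has no isolated points and is
uncountable (`not_countable_prolongation`). Since periods are countable in number, some power
`f^[q]` fixes `x` and has an uncountable set `Z` of fixed points in the prolongation of `x` under
`f^[q]` (`exists_not_countable_prolongation_inter_fixedPoints`).

Next, choose points `y j → x`, each of which travels, much later than its predecessors, close to a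
prescribed `w j ∈ Z` and stays there during a full residue system modulo the periods of the earlier
ones (`exists_slow_sequence`). With `P = {x} ∪ {y j}`, arithmetic of the periods allows, for any
`z, z' ∈ Z`, to bring back all of `P` except for one point sent near `z` and one sent near `z'`:
some iterates of `P` under `f^[q]` converge to `P ∪ {z, z'}` (`exists_capturing_set`).

The scrambled set consists of the sets `P ∪ {v}`, for `v ∈ Z` outside the orbits of `P` and with at
most one `v` in each orbit. Taking `z = z' = x` they are simultaneously recurrent, hence not
asymptotic; taking `z = v`, `z' = v'`, the sets `P ∪ {v}` and `P ∪ {v'}` both approach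
`P ∪ {v, v'}` at the same times, hence are proximal; taking `z = z' = w`, the uncountably many sets
`P ∪ {v, w}` are in the ω-limit set of `P ∪ {v}`, and not in that of `P ∪ {v'}`, whose elements all
meet the orbit of `v'`.
-/

namespace HyperDyn

/-! ### Limit sets, recurrence and equicontinuity -/

theorem finite_range_iterate {Y : Type*} {g : Y → Y} {x : Y}
    (hx : x ∈ Function.periodicPts g) :
    (Set.range fun n : ℕ => g^[n] x).Finite := by
  obtain ⟨p, hp, hpx⟩ := hx
  refine ((Set.finite_lt_nat p).image fun n => g^[n] x).subset ?_
  rintro _ ⟨n, rfl⟩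
  exact ⟨n % p, Nat.mod_lt _ hp, hpx.iterate_mod_apply n⟩

theorem exists_iterate_iterate_eq {Y : Type*} {g : Y → Y} {x : Y}
    (hx : x ∈ Function.periodicPts g) (n : ℕ) :
    ∃ m, g^[m] (g^[n] x) = x := by
  obtain ⟨p, hp, hpx⟩ := hx
  refine ⟨n * p - n, ?_⟩
  rw [← Function.iterate_add_apply, Nat.sub_add_cancel (Nat.le_mul_of_pos_right n hp)]
  exact hpx.const_mul n

theorem PointwisePeriodic.iterate {Y : Type*} [MetricSpace Y] {g : Y → Y}
    (h : PointwisePeriodic g) (q : ℕ) : PointwisePeriodic g^[q] := fun z => by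
  obtain ⟨p, hp, hz⟩ := h z
  refine ⟨p, hp, ?_⟩
  rw [Function.IsPeriodicPt, ← Function.iterate_mul]
  exact hz.const_mul q

section Dynamics

variable {Y : Type*} [MetricSpace Y] {g : Y → Y} {x y u : Y}

theorem mem_omegaSet_iff :
    y ∈ omegaSet g x ↔ ∀ ε > 0, ∀ M : ℕ, ∃ n ≥ M, dist (g^[n] x) y < ε := by
  simp only [omegaSet_eq, Set.mem_iInter, Metric.mem_closure_iff]
  constructor
  · intro h ε hε M
    obtain ⟨_, ⟨k, hk, rfl⟩, h⟩ := h M ε hε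
    exact ⟨k, hk, by rwa [dist_comm]⟩
  · intro h M ε hε
    obtain ⟨k, hk, h⟩ := h ε hε M
    exact ⟨_, ⟨k, hk, rfl⟩, by rwa [dist_comm]⟩

/-- Points whose orbits come arbitrarily close to one and the same point at common times
form a proximal pair. -/
theorem isProximal_of_forall_exists {g : Y → Y} {x y w : Y}
    (h : ∀ ε > 0, ∀ M : ℕ, ∃ n ≥ M, dist (g^[n] x) w < ε ∧ dist (g^[n] y) w < ε) :
    IsProximal g x y := by
  refine le_antisymm (le_of_forall_gt fun c hc => ?_) bot_le
  obtain ⟨ε, hε, hεc⟩ := ENNReal.lt_iff_exists_real_btwn.1 hc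
  have hε0 : 0 < ε := by simpa using hεc.1
  refine lt_of_le_of_lt (liminf_le_of_frequently_le' (x := ENNReal.ofReal ε)
    (frequently_atTop.2 fun M => ?_)) hεc.2
  obtain ⟨n, hn, h1, h2⟩ := h (ε / 2) (by positivity) M
  refine ⟨n, hn, ?_⟩
  rw [edist_dist]
  refine ENNReal.ofReal_le_ofReal ?_
  have := dist_triangle_right (g^[n] x) (g^[n] y) w
  linarith

theorem IsProximal.exists_dist_lt (h : IsProximal g x y) {ε : ℝ} (hε : 0 < ε) :
    ∃ n, dist (g^[n] x) (g^[n] y) < ε := by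
  have : liminf (fun n : ℕ => edist (g^[n] x) (g^[n] y)) atTop < ENNReal.ofReal ε := by
    rw [IsProximal] at h
    rw [h]
    simpa using hε
  obtain ⟨n, hn⟩ := (frequently_lt_of_liminf_lt (by isBoundedDefault) this).exists
  exact ⟨n, by rwa [edist_lt_ofReal] at hn⟩

theorem isAsymptotic_iff :
    IsAsymptotic g x y ↔ ∀ ε > 0, ∃ M : ℕ, ∀ n ≥ M, dist (g^[n] x) (g^[n] y) < ε := by
  constructor
  · intro h ε hε
    have : limsup (fun n : ℕ => edist (g^[n] x) (g^[n] y)) atTop < ENNReal.ofReal ε := by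
      rw [IsAsymptotic] at h
      rw [h]
      simpa using hε
    obtain ⟨M, hM⟩ := eventually_atTop.1 (eventually_lt_of_limsup_lt this (by isBoundedDefault))
    exact ⟨M, fun n hn => by simpa [edist_lt_ofReal] using hM n hn⟩
  · intro h
    refine Tendsto.limsup_eq ?_
    have : Tendsto (fun n : ℕ => dist (g^[n] x) (g^[n] y)) atTop (𝓝 0) := by
      refine Metric.tendsto_atTop.2 fun ε hε => ?_
      obtain ⟨M, hM⟩ := h ε hε
      exact ⟨M, fun n hn => by simpa [abs_of_nonneg dist_nonneg] using hM n hn⟩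
    simpa [edist_dist] using ENNReal.tendsto_ofReal this

/-- Two distinct points returning close to themselves at common times are not asymptotic. -/
theorem not_isAsymptotic_of_forall_exists (hxy : x ≠ y)
    (h : ∀ ε > 0, ∀ M : ℕ, ∃ n ≥ M, dist (g^[n] x) x < ε ∧ dist (g^[n] y) y < ε) :
    ¬ IsAsymptotic g x y := by
  intro ha
  have h0 := dist_pos.2 hxy
  obtain ⟨M, hM⟩ := isAsymptotic_iff.1 ha (dist x y / 3) (by positivity)
  obtain ⟨n, hn, h1, h2⟩ := h (dist x y / 3) (by positivity) M
  have h3 := hM n hn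
  have := dist_triangle4 x (g^[n] x) (g^[n] y) y
  rw [dist_comm x (g^[n] x)] at this
  linarith

theorem omegaSet_inter_nonempty {w : Y}
    (h : ∀ ε > 0, ∀ M : ℕ, ∃ n ≥ M, dist (g^[n] x) w < ε ∧ dist (g^[n] y) w < ε) :
    (omegaSet g x ∩ omegaSet g y).Nonempty :=
  ⟨w, mem_omegaSet_iff.2 fun ε hε M => (h ε hε M).imp fun _ hn => ⟨hn.1, hn.2.1⟩,
    mem_omegaSet_iff.2 fun ε hε M => (h ε hε M).imp fun _ hn => ⟨hn.1, hn.2.2⟩⟩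

theorem finite_omegaSet_of_mem_periodicPts (hx : x ∈ Function.periodicPts g) :
    (omegaSet g x).Finite := by
  have hfin := finite_range_iterate hx
  refine hfin.subset fun y hy => ?_
  rw [← hfin.isClosed.closure_eq, Metric.mem_closure_iff]
  intro ε hε
  obtain ⟨n, -, hn⟩ := mem_omegaSet_iff.1 hy ε hε 0
  exact ⟨_, ⟨n, rfl⟩, by rwa [dist_comm]⟩

theorem omegaSet_subset_of_mem (hg : Continuous g) (hy : y ∈ omegaSet g x) :
    omegaSet g y ⊆ omegaSet g x := by
  intro u hu
  rw [mem_omegaSet_iff] at *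
  intro ε hε M
  obtain ⟨m, hm, h1⟩ := hu (ε / 2) (by positivity) M
  obtain ⟨δ, hδ, h2⟩ := Metric.continuousAt_iff.1 (hg.iterate m).continuousAt (ε / 2) (by positivity)
  obtain ⟨n, hn, h3⟩ := hy δ hδ M
  refine ⟨m + n, by omega, ?_⟩
  have h4 := h2 h3
  rw [Function.iterate_add_apply]
  have := dist_triangle (g^[m] (g^[n] x)) (g^[m] y) u
  linarith

/-- The ω-limit set of an almost periodic point is minimal. -/
theorem omegaSet_subset_of_mem_almostPeriodicPts (hg : Continuous g)
    (hx : x ∈ almostPeriodicPts g) (hu : u ∈ omegaSet g x) : omegaSet g x ⊆ omegaSet g u := by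
  refine omegaSet_subset_of_mem hg (mem_omegaSet_iff.2 fun ε hε M => ?_)
  obtain ⟨N, hN⟩ := hx _ (Metric.ball_mem_nhds x (half_pos hε))
  -- a time at which the orbit of `x` shadows that of `u` for `M + N` steps
  have hev : ∀ᶠ v in 𝓝 u, ∀ t ∈ Finset.range (M + N + 1), dist (g^[t] v) (g^[t] u) < ε / 2 :=
    (Finset.eventually_all _).2 fun t _ =>
      Metric.tendsto_nhds.1 (hg.iterate t).continuousAt.tendsto _ (half_pos hε)
  obtain ⟨δ, hδ, h⟩ := Metric.eventually_nhds_iff.1 hev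
  obtain ⟨n, -, hn⟩ := mem_omegaSet_iff.1 hu δ hδ 0
  obtain ⟨i, hi, hiU⟩ := hN (n + M)
  refine ⟨M + i, by omega, ?_⟩
  have h1 := h hn (M + i) (Finset.mem_range.2 (by omega))
  rw [← Function.iterate_add_apply, dist_comm] at h1
  rw [Metric.mem_ball, show n + M + i = M + i + n by ring] at hiU
  have := dist_triangle (g^[M + i] u) (g^[M + i + n] x) x
  linarith

theorem IsEquicontinuous.exists_delta [CompactSpace Y] (h : IsEquicontinuous g) {ε : ℝ}
    (hε : 0 < ε) :
    ∃ δ > 0, ∀ x y, dist x y < δ → ∀ n : ℕ, dist (g^[n] x) (g^[n] y) < ε :=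
  Metric.uniformEquicontinuous_iff.1 (CompactSpace.uniformEquicontinuous_of_equicontinuous h) ε hε

theorem IsEquicontinuous.not_isLiYorkePair [CompactSpace Y] (h : IsEquicontinuous g) :
    ¬ IsLiYorkePair g x y := by
  rintro ⟨hp, ha⟩
  refine ha (isAsymptotic_iff.2 fun ε hε => ?_)
  obtain ⟨δ, hδ, h⟩ := h.exists_delta hε
  obtain ⟨m, hm⟩ := hp.exists_dist_lt hδ
  refine ⟨m, fun n hn => ?_⟩
  obtain ⟨k, rfl⟩ := Nat.exists_eq_add_of_le' hn
  simpa only [Function.iterate_add_apply] using h _ _ hm k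

/-- In an equicontinuous system every ω-limit set is minimal. -/
theorem IsEquicontinuous.omegaSet_subset [CompactSpace Y] (h : IsEquicontinuous g)
    (hu : u ∈ omegaSet g x) : omegaSet g x ⊆ omegaSet g u := by
  intro v hv
  rw [mem_omegaSet_iff] at *
  intro ε hε M
  obtain ⟨δ, hδ, h⟩ := h.exists_delta (half_pos hε)
  obtain ⟨m, -, hm⟩ := hu δ hδ 0
  obtain ⟨n, hn, hnv⟩ := hv (ε / 2) (half_pos hε) (M + m)
  obtain ⟨k, rfl⟩ := Nat.exists_eq_add_of_le' (show m ≤ n by omega)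
  refine ⟨k, by omega, ?_⟩
  have h1 := h _ _ hm k
  rw [← Function.iterate_add_apply, dist_comm] at h1
  have := dist_triangle (g^[k] u) (g^[k + m] x) v
  linarith

theorem IsEquicontinuous.recurrentPts_subset [CompactSpace Y] (h : IsEquicontinuous g) :
    recurrentPts g ⊆ almostPeriodicPts g := by
  intro x hx
  replace hx : x ∈ omegaSet g x := hx
  rw [mem_omegaSet_iff] at hx
  intro U hU
  obtain ⟨ε, hε, hεU⟩ := Metric.mem_nhds_iff.1 hU
  obtain ⟨δ, hδ, h⟩ := h.exists_delta (half_pos hε)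
  -- finitely many points of the orbit, all reached by time `K`, are `δ`-dense in it
  obtain ⟨t, htsub, htfin, ht⟩ := Metric.finite_approx_of_totallyBounded
    (isCompact_univ.totallyBounded.subset (Set.subset_univ (Set.range fun n : ℕ => g^[n] x))) δ hδ
  obtain ⟨K, hK⟩ : ∃ K : ℕ, ∀ y ∈ t, ∃ k ≤ K, g^[k] x = y := by
    refine ((htfin.eventually_all (l := atTop)).2 fun y hy => ?_).exists
    obtain ⟨k, rfl⟩ := htsub hy
    exact (eventually_ge_atTop k).mono fun K hK => ⟨k, hK, rfl⟩
  obtain ⟨m, hm, hmx⟩ := hx (ε / 2) (half_pos hε) K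
  refine ⟨m, fun n => ?_⟩
  obtain ⟨y, hy, hnk⟩ := Set.mem_iUnion₂.1 (ht ⟨n, rfl⟩)
  obtain ⟨k, hk, rfl⟩ := hK y hy
  have hkm : k ≤ m := hk.trans hm
  refine ⟨m - k, Nat.sub_le _ _, hεU ?_⟩
  have h1 := h _ _ hnk (m - k)
  rw [← Function.iterate_add_apply, ← Function.iterate_add_apply, Nat.sub_add_cancel hkm,
    add_comm] at h1
  have := dist_triangle (g^[n + (m - k)] x) (g^[m] x) x
  rw [Metric.mem_ball]
  linarith

end Dynamics

/-! ### The prolongation of a fixed point -/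

section Prolongation

variable {X : Type*} [MetricSpace X] {g : X → X} {x w : X}

/-- The (first positive) prolongation of `x` under `g`: the points that are limits of
`g^[kᵢ] yᵢ` for some sequence `yᵢ → x` and some times `kᵢ ≥ 0`. -/
def prolongation (g : X → X) (x : X) : Set X :=
  {w | ∀ ε > 0, ∃ y, dist y x < ε ∧ ∃ n : ℕ, dist (g^[n] y) w < ε}

theorem self_mem_prolongation (g : X → X) (x : X) : x ∈ prolongation g x :=
  fun ε hε => ⟨x, by simpa, 0, by simpa⟩

theorem isClosed_prolongation (g : X → X) (x : X) : IsClosed (prolongation g x) := by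
  refine isClosed_of_closure_subset fun w hw ε hε => ?_
  obtain ⟨v, hv, hwv⟩ := Metric.mem_closure_iff.1 hw (ε / 2) (half_pos hε)
  obtain ⟨y, hy, n, hn⟩ := hv (ε / 2) (half_pos hε)
  refine ⟨y, by linarith, n, ?_⟩
  have := dist_triangle_right (g^[n] y) w v
  linarith

theorem iterate_mem_prolongation (hg : Continuous g) (hw : w ∈ prolongation g x) (k : ℕ) :
    g^[k] w ∈ prolongation g x := by
  intro ε hε
  obtain ⟨δ, hδ, h⟩ := Metric.continuousAt_iff.1 (hg.iterate k).continuousAt ε hε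
  obtain ⟨y, hy, n, hn⟩ := hw (min δ ε) (lt_min hδ hε)
  refine ⟨y, hy.trans_le (min_le_right _ _), k + n, ?_⟩
  rw [Function.iterate_add_apply]
  exact h (hn.trans_le (min_le_left _ _))

/-- Orbits starting close enough to `x` avoid a given compact set disjoint from the
prolongation of `x`. -/
theorem exists_forall_iterate_notMem {C : Set X} (hC : IsCompact C)
    (h : Disjoint C (prolongation g x)) :
    ∃ ε > 0, ∀ y, dist y x < ε → ∀ n : ℕ, g^[n] y ∉ C := by
  have hloc : ∀ c ∈ C, ∃ ε > 0, ∀ y, dist y x < ε → ∀ n : ℕ, ε ≤ dist (g^[n] y) c := by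
    intro c hc
    have hc' : c ∉ prolongation g x := Set.disjoint_left.1 h hc
    simpa only [prolongation, Set.mem_ofPred_eq, not_forall, not_exists, not_and, not_lt,
      exists_prop] using hc'
  choose! r hr0 hr using hloc
  obtain ⟨t, ht, hCt⟩ := hC.elim_nhds_subcover (fun c => Metric.ball c (r c))
    fun c hc => Metric.ball_mem_nhds c (hr0 c hc)
  have hev : ∀ᶠ y in 𝓝 x, ∀ c ∈ t, dist y x < r c :=
    (Finset.eventually_all _).2 fun c hc => Metric.ball_mem_nhds x (hr0 c (ht c hc))
  obtain ⟨ε, hε, h⟩ := Metric.eventually_nhds_iff.1 hev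
  refine ⟨ε, hε, fun y hy n hn => ?_⟩
  obtain ⟨c, hc, hyc⟩ := Set.mem_iUnion₂.1 (hCt hn)
  exact (hr c (ht c hc) y (h hy c hc) n).not_gt hyc

/-- If `w` is in the prolongation of `x` under `g`, then one of `w, g w, …, g^[m] w` is in the
prolongation of `x` under `g^[m]`. -/
theorem exists_iterate_mem_prolongation (hg : Continuous g) {m : ℕ} (hm : 0 < m)
    (hw : w ∈ prolongation g x) : ∃ s ≤ m, g^[m - s] w ∈ prolongation g^[m] x := by
  by_contra! hnot
  have hloc : ∀ s, ∃ ε > 0, s ≤ m → ∀ y, dist y x < ε → ∀ n : ℕ,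
      ε ≤ dist ((g^[m])^[n] y) (g^[m - s] w) := by
    intro s
    by_cases hs : s ≤ m
    · simpa only [prolongation, Set.mem_ofPred_eq, not_forall, not_exists, not_and, not_lt,
        exists_prop, hs, true_imp_iff] using hnot s hs
    · exact ⟨1, one_pos, fun h => absurd h hs⟩
  choose r hr0 hr using hloc
  have hev : ∀ᶠ ε in 𝓝[>] (0 : ℝ), ∀ s ∈ Finset.range m, ε < r s ∧ ∀ v, dist v w < ε →
      dist (g^[m - s] v) (g^[m - s] w) < r s := by
    refine (Finset.eventually_all _).2 fun s _ => ?_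
    obtain ⟨δ, hδ, h⟩ := Metric.continuousAt_iff.1
      (hg.iterate (m - s)).continuousAt (r s) (hr0 s)
    filter_upwards [Ioo_mem_nhdsGT (lt_min (hr0 s) hδ)] with ε hε
    rw [Set.mem_Ioo, lt_min_iff] at hε
    exact ⟨hε.2.1, fun v hv => h (hv.trans hε.2.2)⟩
  obtain ⟨ε, hε, hε0⟩ := (hev.and self_mem_nhdsWithin).exists
  obtain ⟨y, hy, n, hn⟩ := hw ε hε0
  -- rounding the time `n` up to a multiple of `m`
  have hs : n % m < m := Nat.mod_lt _ hm
  obtain ⟨h1, h2⟩ := hε (n % m) (Finset.mem_range.2 hs)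
  have h3 := h2 _ hn
  rw [← Function.iterate_add_apply] at h3
  have h4 := hr (n % m) hs.le y (hy.trans h1) (n / m + 1)
  rw [← Function.iterate_mul] at h4
  have : m * (n / m + 1) = m - n % m + n := by
    have := Nat.mod_add_div n m
    rw [mul_add, mul_one]
    omega
  rw [this] at h4
  exact h4.not_gt h3

variable [CompactSpace X]

/-- The prolongation does not split off a closed forward invariant part containing `x`: orbits
starting near `x` and reaching the complementary part would have to leave a neighbourhood of `K`
through the prolongation. -/
theorem prolongation_subset_of_isClosed_diff (hg : Continuous g) {K : Set X} (hK : IsClosed K)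
    (hxK : x ∈ K) (hgK : Set.MapsTo g K K) (hK' : IsClosed (prolongation g x \ K)) :
    prolongation g x ⊆ K := by
  intro w hw
  by_contra hwK
  obtain ⟨U, V, hU, hV, hKU, hKV, hUV⟩ :=
    normal_separation hK hK' (Set.disjoint_sdiff_right)
  -- `C` contains every exit point of `U`
  set C : Set X := closure U \ (U ∩ g ⁻¹' U) with hCdef
  have hC : IsCompact C :=
    (isClosed_closure.sdiff (hU.inter (hU.preimage hg))).isCompact
  have hdisj : Disjoint C (prolongation g x) := by
    refine Set.disjoint_left.2 fun c hc hcD => hc.2 ?_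
    have hcK : c ∈ K := by
      by_contra hcK
      exact Set.disjoint_left.1 (hUV.closure_left hV) hc.1 (hKV ⟨hcD, hcK⟩)
    exact ⟨hKU hcK, hKU (hgK hcK)⟩
  obtain ⟨ε, hε, hεC⟩ := exists_forall_iterate_notMem hC hdisj
  obtain ⟨ε', hε', hU'⟩ := Metric.isOpen_iff.1 hU x (hKU hxK)
  obtain ⟨ε'', hε'', hV'⟩ := Metric.isOpen_iff.1 hV w (hKV ⟨hw, hwK⟩)
  obtain ⟨y, hy, n, hn⟩ := hw (min ε (min ε' ε'')) (by positivity)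
  simp only [lt_min_iff] at hy hn
  have hyU : ∀ n : ℕ, g^[n] y ∈ U := by
    intro n
    induction n with
    | zero => exact hU' hy.2.1
    | succ n ih =>
      rw [Function.iterate_succ_apply']
      by_contra hn
      exact hεC y hy.1 n ⟨subset_closure ih, fun h => hn h.2⟩
  exact Set.disjoint_left.1 hUV (hyU n) (hV' hn.2.2)

/-- If the prolongation of `x` reduces to `x`, then `x` is a Lyapunov stable fixed point. -/
theorem exists_delta_of_prolongation_subset (h : prolongation g x ⊆ {x}) {ε : ℝ} (hε : 0 < ε) :
    ∃ δ > 0, ∀ y, dist y x < δ → ∀ n : ℕ, dist (g^[n] y) x < ε := by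
  obtain ⟨δ, hδ, h⟩ := exists_forall_iterate_notMem (g := g) (x := x)
    (Metric.isOpen_ball (x := x) (ε := ε)).isClosed_compl.isCompact
    (Set.disjoint_left.2 fun c hc hcD => hc (by
      rw [Set.mem_singleton_iff.1 (h hcD)]; exact Metric.mem_ball_self hε))
  exact ⟨δ, hδ, fun y hy n => by simpa using h y hy n⟩

/-- For a pointwise periodic map, the prolongation of a fixed point which is not Lyapunov
stable has no isolated points, hence is uncountable. -/
theorem not_countable_prolongation (hg : Continuous g) (hper : PointwisePeriodic g)
    (hx : g x = x) (hD : ¬ prolongation g x ⊆ {x}) : ¬ (prolongation g x).Countable := by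
  have hperf : Perfect (prolongation g x) := by
    refine ⟨isClosed_prolongation g x, preperfect_iff_nhds.2 fun z hz U hU => ?_⟩
    by_contra! hiso
    set O : Set X := Set.range fun n : ℕ => g^[n] z with hO
    have hOfin : O.Finite := finite_range_iterate (hper z)
    have hgO : Set.MapsTo g O O := by
      rintro _ ⟨n, rfl⟩
      exact ⟨n + 1, Function.iterate_succ_apply' g n z⟩
    -- all points of the orbit of `z` are isolated in the prolongation
    have hOcl : IsClosed (prolongation g x \ O) := by
      refine isClosed_of_closure_subset fun v hv => ?_
      refine ⟨closure_minimal Set.sdiff_subset (isClosed_prolongation g x) hv, ?_⟩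
      rintro ⟨n, rfl⟩
      obtain ⟨m, hm⟩ := exists_iterate_iterate_eq (hper z) n
      obtain ⟨v, hvU, hvD, hvO⟩ := mem_closure_iff_nhds.1 hv (g^[m] ⁻¹' U)
        ((hg.iterate m).continuousAt.preimage_mem_nhds (by simpa only [hm] using hU))
      have hvz : g^[m] v = z := hiso _ ⟨hvU, iterate_mem_prolongation hg hvD m⟩
      obtain ⟨k, hk⟩ := exists_iterate_iterate_eq (hper v) m
      exact hvO ⟨k, by rw [← hk, hvz]⟩
    by_cases hxO : x ∈ O
    · have hsub := prolongation_subset_of_isClosed_diff hg hOfin.isClosed hxO hgO hOcl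
      refine hD fun w hw => ?_
      obtain ⟨n, rfl⟩ := hsub hw
      obtain ⟨m, hm⟩ := hxO
      obtain ⟨k, hk⟩ := exists_iterate_iterate_eq (hper z) m
      have hzx : z = x := by
        rw [← hk]
        simp only at hm
        rw [hm, Function.iterate_fixed hx]
      simp [hzx, Function.iterate_fixed hx]
    · have hsub := prolongation_subset_of_isClosed_diff (K := prolongation g x \ O) hg hOcl
        ⟨self_mem_prolongation g x, hxO⟩ ?_ ?_
      · exact (hsub hz).2 ⟨0, rfl⟩
      · rintro v ⟨hvD, hvO⟩
        refine ⟨iterate_mem_prolongation hg hvD 1, ?_⟩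
        rintro ⟨n, hn⟩
        obtain ⟨k, hk⟩ := exists_iterate_iterate_eq (hper v) 1
        refine hvO ⟨k + n, ?_⟩
        simp only at hn
        simp only [Function.iterate_add_apply, hn]
        exact hk
      · rw [Set.sdiff_sdiff_right_self]
        exact (isClosed_prolongation g x).inter hOfin.isClosed
  obtain ⟨φ, hφ, -, hinj⟩ := hperf.exists_nat_bool_injection ⟨x, self_mem_prolongation g x⟩
  intro hc
  have hcB : Countable (ℕ → Bool) := Set.countable_univ_iff.1
    (Set.countable_of_injective_of_countable_image hinj.injOn
      (hc.mono (by rintro _ ⟨a, -, rfl⟩; exact hφ ⟨a, rfl⟩)))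
  obtain ⟨i, hi⟩ := hcB.exists_injective_nat
  classical
  refine Function.cantor_injective (fun s : Set ℕ => i fun n => decide (n ∈ s)) fun s t hst => ?_
  ext n
  simpa using congrFun (hi hst) n

/-- A power of a pointwise periodic map which is not equicontinuous has a fixed point with
uncountably many fixed points in its prolongation. -/
theorem exists_not_countable_prolongation_inter_fixedPoints {f : X → X} (hf : Continuous f)
    (hper : PointwisePeriodic f) (hne : ¬ IsEquicontinuous f) :
    ∃ q > 0, ∃ x, f^[q] x = x ∧
      ¬ (prolongation f^[q] x ∩ Function.fixedPoints f^[q]).Countable := by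
  obtain ⟨x, hx⟩ := not_forall.1 hne
  obtain ⟨p, hp, hpx⟩ := hper x
  have hgx : f^[p] x = x := hpx
  have hD : ¬ prolongation f^[p] x ⊆ {x} := by
    refine fun hD => hx (Metric.equicontinuousAt_iff.2 fun ε hε => ?_)
    have hev : ∀ᶠ v in 𝓝 x, ∀ s ∈ Finset.range p, dist (f^[s] v) (f^[s] x) < ε :=
      (Finset.eventually_all _).2 fun s _ =>
        Metric.tendsto_nhds.1 (hf.iterate s).continuousAt.tendsto _ hε
    obtain ⟨η, hη, h⟩ := Metric.eventually_nhds_iff.1 hev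
    obtain ⟨δ, hδ, hδη⟩ := exists_delta_of_prolongation_subset hD hη
    refine ⟨δ, hδ, fun y hy n => ?_⟩
    have h1 := h (hδη y hy (n / p)) (n % p) (Finset.mem_range.2 (Nat.mod_lt _ hp))
    rw [← Function.iterate_mul, ← Function.iterate_add_apply, Nat.mod_add_div] at h1
    rwa [dist_comm, ← hpx.iterate_mod_apply n]
  have hunc := not_countable_prolongation (hf.iterate p) (hper.iterate p) hgx hD
  -- some period occurs uncountably often in the prolongation
  obtain ⟨m, hm, hm'⟩ : ∃ m > 0, ¬ (prolongation f^[p] x ∩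
      Function.fixedPoints f^[p * m]).Countable := by
    by_contra! hall
    refine hunc ((Set.countable_iUnion fun m : ℕ => hall (m + 1) m.succ_pos).mono fun z hz => ?_)
    obtain ⟨k, hk, hkz⟩ := hper.iterate p z
    obtain ⟨m, rfl⟩ := Nat.exists_eq_add_of_le' hk
    refine Set.mem_iUnion.2 ⟨m, hz, ?_⟩
    rwa [Function.IsPeriodicPt, ← Function.iterate_mul] at hkz
  refine ⟨p * m, Nat.mul_pos hp hm, x, hpx.mul_const m, fun hc => hm' ?_⟩
  -- the prolongation for `f^[p]` is covered by finitely many images of that for `f^[p * m]`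
  refine ((Set.finite_le_nat m).countable.biUnion fun s _ => hc.image ((f^[p])^[s])).mono ?_
  rintro z ⟨hz, hzfix⟩
  obtain ⟨s, hs, h⟩ := exists_iterate_mem_prolongation (hf.iterate p) hm hz
  rw [← Function.iterate_mul f p m] at h
  refine Set.mem_biUnion hs ⟨_, ⟨h, ?_⟩, ?_⟩
  · rw [Function.mem_fixedPoints, Function.IsFixedPt, ← Function.iterate_mul,
      ← Function.iterate_add_apply, add_comm, Function.iterate_add_apply, hzfix]
  · rw [← Function.iterate_add_apply, Nat.add_sub_cancel' hs, ← Function.iterate_mul]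
    exact hzfix

end Prolongation

/-! ### A compact set whose iterates capture pairs of fixed points -/

theorem iterate_eq_of_modEq {X : Type*} {g : X → X} {y : X} {N a b : ℕ}
    (hy : g^[N] y = y) (h : a ≡ b [MOD N]) :
    g^[a] y = g^[b] y := by
  have hy' : Function.IsPeriodicPt g N y := hy
  rw [← hy'.iterate_mod_apply a, ← hy'.iterate_mod_apply b, h]

section Capture

variable {X : Type*} [MetricSpace X] {g : X → X} {x : X}

/-- Near a fixed point `x` there are points that stay near `x` for a time `T`, and later stay near
a given fixed point `w` of the prolongation during a full residue system modulo `N`. -/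
theorem exists_near_visiting (hg : Continuous g) (hper : PointwisePeriodic g) (hx : g x = x)
    {w : X} (hw : w ∈ prolongation g x) (hgw : g w = w) {ε : ℝ} (hε : 0 < ε) (N T : ℕ)
    (hN : 0 < N) :
    ∃ y, (∀ t ≤ T, dist (g^[t] y) x < ε) ∧ ∃ N' T', 0 < N' ∧ N ∣ N' ∧ g^[N'] y = y ∧ T < T' ∧
      ∀ r, ∃ n, n ≡ r [MOD N] ∧ T ≤ n ∧ n ≤ T' ∧ dist (g^[n] y) w < ε := by
  have hcont : ∀ v, g v = v → ∀ K : ℕ, ∃ δ > 0, ∀ u, dist u v < δ →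
      ∀ t ≤ K, dist (g^[t] u) v < ε := by
    intro v hv K
    have hev : ∀ᶠ u in 𝓝 v, ∀ t ∈ Finset.range (K + 1), dist (g^[t] u) (g^[t] v) < ε :=
      (Finset.eventually_all _).2 fun t _ =>
        Metric.tendsto_nhds.1 (hg.iterate t).continuousAt.tendsto _ hε
    obtain ⟨δ, hδ, h⟩ := Metric.eventually_nhds_iff.1 hev
    refine ⟨δ, hδ, fun u hu t ht => ?_⟩
    simpa only [Function.iterate_fixed hv] using h hu t (Finset.mem_range.2 (by omega))
  obtain ⟨δ₁, hδ₁, h₁⟩ := hcont x hx T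
  obtain ⟨δ₂, hδ₂, h₂⟩ := hcont w hgw N
  obtain ⟨y, hy, k, hk⟩ := hw (min δ₁ δ₂) (lt_min hδ₁ hδ₂)
  obtain ⟨p, hp, hpy⟩ := hper y
  -- delaying by a multiple of the period of `y`, the visit to `w` takes place after time `T`
  set a := k + p * T with ha
  have hay : g^[a] y = g^[k] y := by
    rw [ha, Function.iterate_add_apply, hpy.mul_const T]
  have hTa : T ≤ a := le_add_left (Nat.le_mul_of_pos_left T hp)
  refine ⟨y, h₁ y (hy.trans_le (min_le_left _ _)), N * p, a + N + 1, Nat.mul_pos hN hp,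
    dvd_mul_right _ _, hpy.const_mul N, by omega, fun r => ?_⟩
  have hmod : (r + a * N - a) % N + a ≡ r [MOD N] := by
    have h : a ≤ r + a * N := le_add_left (Nat.le_mul_of_pos_right a hN)
    calc (r + a * N - a) % N + a ≡ r + a * N - a + a [MOD N] := (Nat.mod_modEq _ _).add_right a
      _ = r + a * N := Nat.sub_add_cancel h
      _ ≡ r [MOD N] := by simp [Nat.ModEq]
  have hlt := Nat.mod_lt (r + a * N - a) hN
  refine ⟨(r + a * N - a) % N + a, hmod, by omega, by omega, ?_⟩
  rw [Function.iterate_add_apply, hay]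
  exact h₂ _ (hk.trans_le (min_le_right _ _)) _ hlt.le

/-- A sequence converging to the fixed point `x` whose terms `y j` move slower and slower: before
time `T j` the points `y i`, `i ≥ j`, stay near `x`; the points `y i`, `i < j`, have the common
period `N j`; between the times `T j` and `T (j + 1)`, at instants in any prescribed residue class
modulo `N j`, the point `y j` visits `w j`. -/
theorem exists_slow_sequence (hg : Continuous g) (hper : PointwisePeriodic g) (hx : g x = x)
    {w : ℕ → X} (hw : ∀ j, w j ∈ prolongation g x) (hgw : ∀ j, g (w j) = w j)
    {ε : ℕ → ℝ} (hε : ∀ j, 0 < ε j) :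
    ∃ (y : ℕ → X) (N T : ℕ → ℕ), Monotone T ∧ (∀ j, j ≤ T j) ∧ (∀ i j, i ≤ j → N i ∣ N j) ∧
      (∀ j, ∀ t ≤ T j, dist (g^[t] (y j)) x < ε j) ∧ (∀ i j, i < j → g^[N j] (y i) = y i) ∧
      ∀ j r, ∃ n, n ≡ r [MOD N j] ∧ T j ≤ n ∧ n ≤ T (j + 1) ∧ dist (g^[n] (y j)) (w j) < ε j := by
  have hstep := fun (j : ℕ) (s : {N : ℕ // 0 < N} × ℕ) =>
    exists_near_visiting hg hper hx (hw j) (hgw j) (hε j) s.1 s.2 s.1.2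
  choose y hy N' T' hN' hdvd hyN hT hvisit using hstep
  let s : ℕ → {N : ℕ // 0 < N} × ℕ :=
    fun j => j.rec (⟨1, one_pos⟩, 0) fun j s => (⟨N' j s, hN' j s⟩, T' j s)
  have hTs : StrictMono fun j => (s j).2 := strictMono_nat_of_lt_succ fun j => hT j (s j)
  have hNs : ∀ i j, i ≤ j → ((s i).1 : ℕ) ∣ (s j).1 := fun i j hij => by
    induction j, hij using Nat.le_induction with
    | base => exact dvd_rfl
    | succ j _ ih => exact ih.trans (hdvd j (s j))
  refine ⟨fun j => y j (s j), fun j => (s j).1, fun j => (s j).2, hTs.monotone,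
    fun _ => hTs.le_apply, hNs, fun j => hy j (s j), fun i j hij => ?_, fun j => hvisit j (s j)⟩
  obtain ⟨c, hc⟩ := hNs (i + 1) j hij
  have hp : Function.IsPeriodicPt g (s (i + 1)).1 (y i (s i)) := hyN i (s i)
  have := hp.mul_const c
  rwa [← hc] at this

/-- A nonempty set in a separable metric space contains a sequence returning arbitrarily close to
each of its points. -/
theorem exists_seq_recurring [SecondCountableTopology X] {Z : Set X} (hZ : Z.Nonempty) :
    ∃ w : ℕ → X, (∀ j, w j ∈ Z) ∧ ∀ z ∈ Z, ∀ ε > 0, ∀ M, ∃ j ≥ M, dist (w j) z < ε := by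
  have := hZ.to_subtype
  refine ⟨fun j => TopologicalSpace.denseSeq Z j.unpair.1, fun j => Subtype.coe_prop _,
    fun z hz ε hε M => ?_⟩
  obtain ⟨k, hk⟩ := (TopologicalSpace.denseRange_denseSeq Z).exists_dist_lt ⟨z, hz⟩ hε
  refine ⟨Nat.pair k M, Nat.right_le_pair k M, ?_⟩
  rw [Subtype.dist_eq, dist_comm] at hk
  simpa using hk

/-- There is a countable compact set `P ∋ x` such that, for any fixed points `z`, `z'` in the
prolongation of `x`, some iterates `g^[n] '' P` come back arbitrarily close to `P ∪ {z, z'}`. -/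
theorem exists_capturing_set [SecondCountableTopology X] (hg : Continuous g)
    (hper : PointwisePeriodic g) (hx : g x = x) :
    ∃ P : Set X, IsCompact P ∧ P.Countable ∧ x ∈ P ∧
      ∀ z ∈ prolongation g x ∩ Function.fixedPoints g,
      ∀ z' ∈ prolongation g x ∩ Function.fixedPoints g, ∀ ε > 0, ∀ M : ℕ, ∃ n ≥ M,
        (∀ u ∈ P, ∃ v ∈ P ∪ {z, z'}, dist (g^[n] u) v ≤ ε) ∧
        ∀ v ∈ P ∪ {z, z'}, ∃ u ∈ P, dist (g^[n] u) v ≤ ε := by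
  obtain ⟨w, hwZ, hw⟩ := exists_seq_recurring
    (Z := prolongation g x ∩ Function.fixedPoints g) ⟨x, self_mem_prolongation g x, hx⟩
  obtain ⟨y, N, T, hT, hjT, hN, hnear, hyN, hvisit⟩ := exists_slow_sequence hg hper hx
    (fun j => (hwZ j).1) (fun j => (hwZ j).2) (ε := fun j => 1 / ((j : ℝ) + 1))
    fun j => Nat.one_div_pos_of_nat
  have hy0 : ∀ j, dist (y j) x < 1 / ((j : ℝ) + 1) := fun j => hnear j 0 (Nat.zero_le _)
  have hyx : Tendsto y atTop (𝓝 x) := tendsto_iff_dist_tendsto_zero.2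
    (squeeze_zero (fun _ => dist_nonneg) (fun j => (hy0 j).le)
      tendsto_one_div_add_atTop_nhds_zero_nat)
  refine ⟨insert x (Set.range y), hyx.isCompact_insert_range,
    (Set.countable_range y).insert x, Set.mem_insert _ _, fun z hz z' hz' ε hε M => ?_⟩
  obtain ⟨k, hk⟩ := exists_nat_one_div_lt (half_pos hε)
  have hsmall : ∀ i ≥ k, 1 / ((i : ℝ) + 1) < ε / 2 := fun i hi =>
    (Nat.one_div_le_one_div hi).trans_lt hk
  -- `y j` takes care of `z`, and the much slower `y j'` of `z'`
  obtain ⟨j, hj, hjz⟩ := hw z hz (ε / 2) (half_pos hε) (max k M)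
  obtain ⟨j', hj', hjz'⟩ := hw z' hz' (ε / 2) (half_pos hε) (j + 1)
  obtain ⟨m, hm, -, hmT, hmw⟩ := hvisit j 0
  obtain ⟨n, hn, hTn, hnT, hnw⟩ := hvisit j' m
  have hkj : k ≤ j := (le_max_left _ _).trans hj
  have hMj : M ≤ j := (le_max_right _ _).trans hj
  have hnear' : ∀ i ≥ j, ∀ t ≤ T i, dist (g^[t] (y i)) x ≤ ε := fun i hi t ht => by
    linarith [hnear i t ht, hsmall i (hkj.trans hi)]
  have hearly : ∀ i < j, g^[n] (y i) = y i := fun i hi => by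
    have h1 : n ≡ 0 [MOD N j] := (hn.of_dvd (hN j j' (by omega))).trans hm
    exact iterate_eq_of_modEq (hyN i j hi) h1
  have hmid : ∀ i < j', g^[n] (y i) = g^[m] (y i) := fun i hi =>
    iterate_eq_of_modEq (hyN i j' hi) hn
  have hjn : dist (g^[n] (y j)) z ≤ ε := by
    rw [hmid j (by omega)]
    linarith [dist_triangle (g^[m] (y j)) (w j) z, hsmall j hkj]
  have hjn' : dist (g^[n] (y j')) z' ≤ ε := by
    linarith [dist_triangle (g^[n] (y j')) (w j') z', hsmall j' (by omega)]
  have hgx : g^[n] x = x := Function.iterate_fixed hx n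
  refine ⟨n, ((hMj.trans (by omega)).trans (hjT j')).trans hTn, ?_, ?_⟩
  · rintro _ (rfl | ⟨i, rfl⟩)
    · exact ⟨_, Or.inl (Set.mem_insert _ _), by simp [hgx, hε.le]⟩
    rcases lt_trichotomy i j with hij | rfl | hij
    · exact ⟨y i, Or.inl (Or.inr ⟨i, rfl⟩), by simp [hearly i hij, hε.le]⟩
    · exact ⟨z, Or.inr (Or.inl rfl), hjn⟩
    rcases lt_trichotomy i j' with hij' | rfl | hij'
    · refine ⟨x, Or.inl (Set.mem_insert _ _), ?_⟩
      rw [hmid i hij']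
      exact hnear' i hij.le m (hmT.trans (hT hij))
    · exact ⟨z', Or.inr (Or.inr rfl), hjn'⟩
    · exact ⟨x, Or.inl (Set.mem_insert _ _), hnear' i hij.le n (hnT.trans (hT hij'))⟩
  · rintro _ ((rfl | ⟨i, rfl⟩) | rfl | rfl)
    · exact ⟨_, Set.mem_insert _ _, by simp [hgx, hε.le]⟩
    · rcases lt_or_ge i j with hij | hij
      · exact ⟨y i, Or.inr ⟨i, rfl⟩, by simp [hearly i hij, hε.le]⟩
      · refine ⟨x, Set.mem_insert _ _, ?_⟩
        rw [hgx, dist_comm]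
        exact hnear' i hij 0 (Nat.zero_le _)
    · exact ⟨y j, Or.inr ⟨j, rfl⟩, hjn⟩
    · exact ⟨y j', Or.inr ⟨j', rfl⟩, hjn'⟩

end Capture

/-! ### The induced map on the hyperspace -/

section Hyperspace

open TopologicalSpace

variable {X : Type*} [MetricSpace X] {f : X → X}

theorem coe_iterate_hyperMap (hf : Continuous f) (n : ℕ) (A : NonemptyCompacts X) :
    (((hyperMap f hf)^[n] A : NonemptyCompacts X) : Set X) = f^[n] '' A := by
  induction n with
  | zero => simp
  | succ n ih =>
    rw [Function.iterate_succ_apply', Function.iterate_succ', Set.image_comp, ← ih]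
    rfl

theorem dist_le_of_forall_exists {A B : NonemptyCompacts X} {ε : ℝ} (hε : 0 ≤ ε)
    (h₁ : ∀ a ∈ A, ∃ b ∈ B, dist a b ≤ ε) (h₂ : ∀ b ∈ B, ∃ a ∈ A, dist a b ≤ ε) :
    dist A B ≤ ε := by
  rw [Metric.NonemptyCompacts.dist_eq]
  exact Metric.hausdorffDist_le_of_mem_dist hε h₁ fun b hb =>
    (h₂ b hb).imp fun a ha => ⟨ha.1, by rw [dist_comm]; exact ha.2⟩

theorem exists_dist_lt_of_dist_lt {A B : NonemptyCompacts X} {ε : ℝ} (h : dist A B < ε)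
    {a : X} (ha : a ∈ A) : ∃ b ∈ B, dist a b < ε := by
  rw [Metric.NonemptyCompacts.dist_eq] at h
  exact Metric.exists_dist_lt_of_hausdorffDist_lt ha h
    (Metric.hausdorffEDist_ne_top_of_nonempty_of_bounded A.nonempty B.nonempty
      A.isCompact.isBounded B.isCompact.isBounded)

theorem IsEquicontinuous.hyperMap [CompactSpace X] (hf : Continuous f) (h : IsEquicontinuous f) :
    IsEquicontinuous (hyperMap f hf) := by
  refine fun A => Metric.equicontinuousAt_iff.2 fun ε hε => ?_
  obtain ⟨δ, hδ, h⟩ := h.exists_delta (half_pos hε)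
  have key : ∀ A B : NonemptyCompacts X, dist A B < δ → ∀ n, ∀ a ∈ (HyperDyn.hyperMap f hf)^[n] A,
      ∃ b ∈ (HyperDyn.hyperMap f hf)^[n] B, dist a b ≤ ε / 2 := by
    intro A B hAB n a ha
    rw [← SetLike.mem_coe, coe_iterate_hyperMap] at ha
    obtain ⟨a, ha, rfl⟩ := ha
    obtain ⟨b, hb, hab⟩ := exists_dist_lt_of_dist_lt hAB ha
    refine ⟨f^[n] b, ?_, (h a b hab n).le⟩
    rw [← SetLike.mem_coe, coe_iterate_hyperMap]
    exact ⟨b, hb, rfl⟩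
  refine ⟨δ, hδ, fun B hB n => ?_⟩
  refine (dist_le_of_forall_exists (half_pos hε).le (key A B (by rwa [dist_comm]) n)
    fun b hb => ?_).trans_lt (half_lt_self hε)
  obtain ⟨a, ha, hab⟩ := key B A hB n b hb
  exact ⟨a, ha, by rwa [dist_comm]⟩

/-- A finite set meeting all iterates of `A` meets all their limits. -/
theorem exists_mem_of_mem_omegaSet (hf : Continuous f) {A W : NonemptyCompacts X} {O : Set X}
    (hO : O.Finite) (h : ∀ n, ∃ o ∈ O, o ∈ (hyperMap f hf)^[n] A)
    (hW : W ∈ omegaSet (hyperMap f hf) A) : ∃ o ∈ O, o ∈ W := by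
  by_contra! hOW
  have hev : ∀ᶠ ε in 𝓝[>] (0 : ℝ), ∀ o ∈ O, ∀ v ∈ W, ε ≤ dist o v := by
    refine hO.eventually_all.2 fun o ho => ?_
    obtain ⟨δ, hδ, hδW⟩ := Metric.isOpen_iff.1 W.isCompact.isClosed.isOpen_compl o (hOW o ho)
    filter_upwards [Ioo_mem_nhdsGT hδ] with ε hε v hv
    by_contra! hlt
    refine hδW (a := v) ?_ hv
    rw [Metric.mem_ball, dist_comm]
    exact hlt.trans hε.2
  obtain ⟨ε, hε, hε0⟩ := (hev.and self_mem_nhdsWithin).exists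
  obtain ⟨n, -, hn⟩ := mem_omegaSet_iff.1 hW ε hε0 0
  obtain ⟨o, ho, hoA⟩ := h n
  obtain ⟨v, hv, hov⟩ := exists_dist_lt_of_dist_lt hn hoA
  exact (hε o ho v hv).not_gt hov

/-- The compact set `P ∪ {z}`, for `P` compact. -/
def adjoin {P : Set X} (hP : IsCompact P) (z : X) : NonemptyCompacts X :=
  ⟨⟨insert z P, hP.insert z⟩, Set.insert_nonempty z P⟩

@[simp]
theorem mem_adjoin {P : Set X} {hP : IsCompact P} {z u : X} :
    u ∈ adjoin hP z ↔ u = z ∨ u ∈ P :=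
  Iff.rfl

/-- The capturing property of `P` passes to the hyperspace: adjoining a fixed point `v` of
`f^[q]` to `P`, some iterates of the resulting set come close to `P ∪ {v, z, z'}`, at times
that do not depend on `v`. -/
theorem exists_dist_iterate_adjoin_lt (hf : Continuous f) {q : ℕ} (hq : 0 < q) {P : Set X}
    (hP : IsCompact P) {z z' : X}
    (hcap : ∀ ε > 0, ∀ M : ℕ, ∃ n ≥ M,
      (∀ u ∈ P, ∃ v ∈ P ∪ {z, z'}, dist ((f^[q])^[n] u) v ≤ ε) ∧
        ∀ v ∈ P ∪ {z, z'}, ∃ u ∈ P, dist ((f^[q])^[n] u) v ≤ ε) {ε : ℝ} (hε : 0 < ε) (M : ℕ) :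
    ∃ n ≥ M, ∀ v, f^[q] v = v → ∀ B : NonemptyCompacts X,
      (∀ u, u ∈ B ↔ u = v ∨ u ∈ P ∪ {z, z'}) →
      dist ((hyperMap f hf)^[n] (adjoin hP v)) B < ε := by
  obtain ⟨n, hn, h₁, h₂⟩ := hcap (ε / 2) (half_pos hε) M
  refine ⟨q * n, hn.trans (Nat.le_mul_of_pos_left n hq), fun v hv B hB => ?_⟩
  have hmem : ∀ u, u ∈ (hyperMap f hf)^[q * n] (adjoin hP v) ↔
      ∃ a, (a = v ∨ a ∈ P) ∧ (f^[q])^[n] a = u := fun u => by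
    rw [← SetLike.mem_coe, coe_iterate_hyperMap, ← Function.iterate_mul]
    rfl
  refine (dist_le_of_forall_exists (half_pos hε).le (fun a ha => ?_) fun b hb => ?_).trans_lt
    (half_lt_self hε)
  · obtain ⟨u, rfl | hu, rfl⟩ := (hmem a).1 ha
    · exact ⟨u, (hB u).2 (Or.inl rfl), by
        simpa [Function.iterate_fixed hv] using (half_pos hε).le⟩
    · obtain ⟨b, hb, hub⟩ := h₁ u hu
      exact ⟨b, (hB b).2 (Or.inr hb), hub⟩
  · rcases (hB b).1 hb with rfl | hb
    · exact ⟨b, (hmem b).2 ⟨b, Or.inl rfl, Function.iterate_fixed hv n⟩, by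
        simpa using (half_pos hε).le⟩
    · obtain ⟨u, hu, hub⟩ := h₂ b hb
      exact ⟨_, (hmem _).2 ⟨u, Or.inr hu, rfl⟩, hub⟩

/-- Choosing one point in each orbit of a pointwise periodic map, out of an uncountable set,
leaves an uncountable set. -/
theorem exists_not_countable_subset_iterate_ne {Y : Type*} {f : Y → Y}
    (hper : ∀ y, y ∈ Function.periodicPts f) {Z : Set Y} (hZ : ¬ Z.Countable) :
    ∃ Z' ⊆ Z, ¬ Z'.Countable ∧ ∀ v ∈ Z', ∀ v' ∈ Z', v ≠ v' → ∀ s : ℕ, f^[s] v' ≠ v := by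
  let orb : Y → Set Y := fun z => Set.range fun n : ℕ => f^[n] z
  have hle : ∀ v s, orb (f^[s] v) ⊆ orb v := by
    rintro v s _ ⟨n, rfl⟩
    exact ⟨n + s, Function.iterate_add_apply f n s v⟩
  have horb : ∀ v s, orb (f^[s] v) = orb v := fun v s => by
    refine (hle v s).antisymm ?_
    obtain ⟨m, hm⟩ := exists_iterate_iterate_eq (hper v) s
    have := hle (f^[s] v) m
    rwa [hm] at this
  obtain ⟨Z', hZ'Z, hbij⟩ := Z.exists_subset_bijOn orb
  refine ⟨Z', hZ'Z, fun hc => hZ ?_, fun v hv v' hv' hne s hs => hne ?_⟩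
  · refine (hc.biUnion fun v _ => Set.countable_range fun n : ℕ => f^[n] v).mono fun z hz => ?_
    obtain ⟨v, hv, hvz⟩ := hbij.surjOn ⟨z, hz, rfl⟩
    refine Set.mem_biUnion hv ?_
    change z ∈ orb v
    rw [hvz]
    exact ⟨0, rfl⟩
  · exact hbij.injOn hv hv' (by rw [← hs, horb])

/-- If `f` is pointwise periodic but not equicontinuous, then `hyperMap f` has an uncountable
scrambled and ω-scrambled set of recurrent points. Its elements are the sets `P ∪ {v}`, for `P` a
capturing set and `v` in an uncountable set of fixed points of a power of `f`. -/
theorem exists_scrambled_of_not_isEquicontinuous [CompactSpace X] (hf : Continuous f)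
    (hper : PointwisePeriodic f) (hne : ¬ IsEquicontinuous f) :
    ∃ S : Set (NonemptyCompacts X), ¬ S.Countable ∧ S ⊆ recurrentPts (hyperMap f hf) ∧
      IsScrambled (hyperMap f hf) S ∧ IsOmegaScrambled (hyperMap f hf) S := by
  obtain ⟨q, hq, x, hx, hZ⟩ := exists_not_countable_prolongation_inter_fixedPoints hf hper hne
  obtain ⟨P, hP, hPc, hxP, hcap⟩ := exists_capturing_set (hf.iterate q) (hper.iterate q) hx
  set Z : Set X := prolongation f^[q] x ∩ Function.fixedPoints f^[q] with hZdef
  have hxZ : x ∈ Z := ⟨self_mem_prolongation _ x, hx⟩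
  -- `V` consists of points of `Z` outside the orbits of `P`, at most one in each orbit
  have hOc : (⋃ u ∈ P, Set.range fun n : ℕ => f^[n] u).Countable :=
    hPc.biUnion fun u _ => Set.countable_range _
  obtain ⟨V, hVZ, hV, hVorb⟩ := exists_not_countable_subset_iterate_ne hper
    (fun h => hZ ((h.union hOc).mono fun z hz => by
      rw [Set.sdiff_union_self]; exact Or.inl hz) :
      ¬ (Z \ ⋃ u ∈ P, Set.range fun n : ℕ => f^[n] u).Countable)
  have hVP : ∀ v ∈ V, ∀ n : ℕ, f^[n] v ∉ P := fun v hv n hn => by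
    obtain ⟨m, hm⟩ := exists_iterate_iterate_eq (hper v) n
    exact (hVZ hv).2 (Set.mem_biUnion hn ⟨m, hm⟩)
  have hfix : ∀ v ∈ V, f^[q] v = v := fun v hv => (hVZ hv).1.2
  have hclose : ∀ z ∈ Z, ∀ z' ∈ Z, ∀ ε > 0, ∀ M, ∃ n ≥ M, ∀ v ∈ V, ∀ B : NonemptyCompacts X,
      (∀ u, u ∈ B ↔ u = v ∨ u ∈ P ∪ {z, z'}) →
      dist ((hyperMap f hf)^[n] (adjoin hP v)) B < ε := fun z hz z' hz' ε hε M => by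
    obtain ⟨n, hn, h⟩ := exists_dist_iterate_adjoin_lt hf hq hP (hcap z hz z' hz') hε M
    exact ⟨n, hn, fun v hv => h v (hfix v hv)⟩
  have hrec : ∀ ε > 0, ∀ M, ∃ n ≥ M, ∀ v ∈ V,
      dist ((hyperMap f hf)^[n] (adjoin hP v)) (adjoin hP v) < ε := fun ε hε M => by
    obtain ⟨n, hn, h⟩ := hclose x hxZ x hxZ ε hε M
    refine ⟨n, hn, fun v hv => h v hv _ fun u => ?_⟩
    have : u = x → u ∈ P := fun h => h ▸ hxP
    simp only [mem_adjoin, Set.mem_union, Set.mem_insert_iff, Set.mem_singleton_iff]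
    tauto
  have hrec' : ∀ v ∈ V, adjoin hP v ∈ omegaSet (hyperMap f hf) (adjoin hP v) := fun v hv =>
    mem_omegaSet_iff.2 fun ε hε M => (hrec ε hε M).imp fun n hn => ⟨hn.1, hn.2 v hv⟩
  -- both orbits of the pair pass near `P ∪ {v, v'}` at the same times
  have hprox : ∀ v ∈ V, ∀ v' ∈ V, ∃ B : NonemptyCompacts X, ∀ ε > 0, ∀ M : ℕ, ∃ n ≥ M,
      dist ((hyperMap f hf)^[n] (adjoin hP v)) B < ε ∧
      dist ((hyperMap f hf)^[n] (adjoin hP v')) B < ε := fun v hv v' hv' => by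
    refine ⟨adjoin (hP.insert v') v, fun ε hε M => ?_⟩
    obtain ⟨n, hn, h⟩ := hclose v (hVZ hv).1 v' (hVZ hv').1 ε hε M
    refine ⟨n, hn, h v hv _ fun u => ?_, h v' hv' _ fun u => ?_⟩ <;>
    · simp only [mem_adjoin, Set.mem_union, Set.mem_insert_iff, Set.mem_singleton_iff]
      tauto
  have hinj : Set.InjOn (adjoin hP) V := fun v hv v' hv' h => by
    have : v ∈ adjoin hP v' := h ▸ mem_adjoin.2 (Or.inl rfl)
    exact (mem_adjoin.1 this).resolve_right (hVP v hv 0)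
  have homega : ∀ v ∈ V, ∀ v' ∈ V, v ≠ v' → ¬ (omegaSet (hyperMap f hf) (adjoin hP v) \
      omegaSet (hyperMap f hf) (adjoin hP v')).Countable := by
    intro v hv v' hv' hne hc
    -- for `w` in `Z'`, the set `P ∪ {v, w}` is a limit of iterates of `P ∪ {v}`,
    -- but avoids the orbit of `v'`
    set Z' : Set X := Z \ (insert v P ∪ Set.range fun n : ℕ => f^[n] v') with hZ'
    have hZ'c : ¬ Z'.Countable := fun h => hZ
      ((h.union ((hPc.insert v).union (Set.countable_range fun n : ℕ => f^[n] v'))).mono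
        fun z hz => by rw [hZ', Set.sdiff_union_self]; exact Or.inl hz)
    refine hZ'c (Set.countable_of_injective_of_countable_image
      (f := fun w => adjoin (hP.insert w) v) (fun w hw w' hw' h => ?_) (hc.mono ?_))
    · have : w ∈ adjoin (hP.insert w') v := by
        rw [← show adjoin (hP.insert w) v = adjoin (hP.insert w') v from h]
        exact Or.inr (Or.inl rfl)
      rcases this with rfl | rfl | hwP
      · exact absurd (Or.inl (Or.inl rfl)) hw.2
      · rfl
      · exact absurd (Or.inl (Or.inr hwP)) hw.2
    · rintro _ ⟨w, hw, rfl⟩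
      refine ⟨mem_omegaSet_iff.2 fun ε hε M => ?_, fun hW => ?_⟩
      · obtain ⟨n, hn, h⟩ := hclose w hw.1 w hw.1 ε hε M
        refine ⟨n, hn, h v hv _ fun u => ?_⟩
        simp only [mem_adjoin, Set.mem_union, Set.mem_insert_iff, Set.mem_singleton_iff]
        tauto
      · obtain ⟨_, ⟨s, rfl⟩, hs⟩ := exists_mem_of_mem_omegaSet hf (finite_range_iterate (hper v'))
          (fun n => ⟨_, ⟨n, rfl⟩, by
            rw [← SetLike.mem_coe, coe_iterate_hyperMap]
            exact ⟨v', Or.inl rfl, rfl⟩⟩) hW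
        rcases hs with hs | hs | hs
        · exact hVorb v hv v' hv' hne s hs
        · exact hw.2 (Or.inr ⟨s, hs⟩)
        · exact hVP v' hv' s hs
  have hS : ¬ (adjoin hP '' V).Countable := fun h =>
    hV (Set.countable_of_injective_of_countable_image hinj h)
  refine ⟨adjoin hP '' V, hS, ?_, ?_, Set.Infinite.nontrivial fun h => hS h.countable, ?_⟩
  · rintro _ ⟨v, hv, rfl⟩
    exact hrec' v hv
  · rintro _ ⟨v, hv, rfl⟩ _ ⟨v', hv', rfl⟩ hne
    obtain ⟨B, hB⟩ := hprox v hv v' hv'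
    exact ⟨isProximal_of_forall_exists hB, not_isAsymptotic_of_forall_exists hne fun ε hε M =>
      (hrec ε hε M).imp fun n hn => ⟨hn.1, hn.2 v hv, hn.2 v' hv'⟩⟩
  · rintro _ ⟨v, hv, rfl⟩ _ ⟨v', hv', rfl⟩ hne
    have hunc := homega v hv v' hv' fun h => hne (h ▸ rfl)
    obtain ⟨B, hB⟩ := hprox v hv v' hv'
    refine ⟨hunc, omegaSet_inter_nonempty hB, fun hsub => hunc ?_⟩
    -- the recurrent set `P ∪ {v}` has an infinite ω-limit set, so it is not periodic
    exact ((finite_omegaSet_of_mem_periodicPts (hsub (hrec' v hv))).subset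
      Set.sdiff_subset).countable

end Hyperspace

end HyperDyn

theorem theorem6p2 {X : Type*} [MetricSpace X] [CompactSpace X] (f : X ≃ₜ X)
    (hf : HyperDyn.PointwisePeriodic f) :
    List.TFAE [
      ¬ HyperDyn.IsEquicontinuous f,
      ¬ HyperDyn.IsEquicontinuous (HyperDyn.hyperMap f f.continuous),
      (∃ S : Set (TopologicalSpace.NonemptyCompacts X),
          ¬ S.Countable ∧
          S ⊆ HyperDyn.recurrentPts (HyperDyn.hyperMap f f.continuous) ∧
          HyperDyn.IsScrambled (HyperDyn.hyperMap f f.continuous) S ∧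
          HyperDyn.IsOmegaScrambled (HyperDyn.hyperMap f f.continuous) S) ∧
        HyperDyn.IsLiYorkeChaotic (HyperDyn.hyperMap f f.continuous) ∧
        HyperDyn.IsOmegaChaotic (HyperDyn.hyperMap f f.continuous),
      ∃ A B : TopologicalSpace.NonemptyCompacts X,
        HyperDyn.IsLiYorkePair (HyperDyn.hyperMap f f.continuous) A B,
      ∃ S : Set (TopologicalSpace.NonemptyCompacts X),
        S.Nontrivial ∧ HyperDyn.IsOmegaScrambled (HyperDyn.hyperMap f f.continuous) S,
      (HyperDyn.recurrentPts (HyperDyn.hyperMap f f.continuous) \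
        HyperDyn.almostPeriodicPts (HyperDyn.hyperMap f f.continuous)).Nonempty] := by
  have hF : Continuous (HyperDyn.hyperMap f f.continuous) :=
    f.continuous.nonemptyCompacts_map
  tfae_have 1 → 3 := fun h => by
    obtain ⟨S, hS, hR, hscr, hom⟩ :=
      HyperDyn.exists_scrambled_of_not_isEquicontinuous f.continuous hf h
    exact ⟨⟨S, hS, hR, hscr, hom⟩, ⟨S, hS, hscr⟩, S, hS, hom⟩
  tfae_have 3 → 4 := by
    rintro ⟨⟨S, -, -, hscr, ⟨A, hA, B, hB, hAB⟩, -⟩, -⟩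
    exact ⟨A, B, hscr A hA B hB hAB⟩
  tfae_have 4 → 2 := fun ⟨A, B, hAB⟩ h => h.not_isLiYorkePair hAB
  tfae_have 3 → 5 := by
    rintro ⟨⟨S, -, -, -, hom⟩, -⟩
    exact ⟨S, hom.1, hom⟩
  tfae_have 5 → 2 := by
    rintro ⟨S, ⟨A, hA, B, hB, hAB⟩, -, hS⟩ h
    obtain ⟨hunc, ⟨C, hCA, hCB⟩, -⟩ := hS A hA B hB hAB
    refine hunc ?_
    rw [Set.sdiff_eq_empty.2
      ((h.omegaSet_subset hCA).trans (HyperDyn.omegaSet_subset_of_mem hF hCB))]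
    exact Set.countable_empty
  tfae_have 3 → 6 := by
    rintro ⟨⟨S, -, hR, -, ⟨A, hA, B, hB, hAB⟩, hS⟩, -⟩
    obtain ⟨hunc, ⟨C, hCA, hCB⟩, -⟩ := hS A hA B hB hAB
    refine ⟨A, hR hA, fun hAP => hunc ?_⟩
    rw [Set.sdiff_eq_empty.2 ((HyperDyn.omegaSet_subset_of_mem_almostPeriodicPts hF hAP hCA).trans
      (HyperDyn.omegaSet_subset_of_mem hF hCB))]
    exact Set.countable_empty
  tfae_have 6 → 2 := fun ⟨A, hR, hAP⟩ h => hAP (h.recurrentPts_subset hR)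
  tfae_have 2 → 1 := fun h h' => h (h'.hyperMap f.continuous)
  tfae_finish
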